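/- All algebras have type $\langle 2,2,1\rangle$, are written $\mathbf{A}=\langle A,\wedge,\vee,\lnot\rangle$ and have a non-empty universe; a variety is a class of algebras closed under homomorphic images, subalgebras and direct products, and $V(K)$ is the smallest variety containing $K$. A *De Morgan bisemilattice* is an algebra such that $\langle A,\wedge\rangle$ and $\langle A,\vee\rangle$ are semilattices, $\wedge$ and $\vee$ distribute over each other, and $\lnot\lnot x\approx x$, $\lnot(x\wedge y)\approx\lnot x\vee\lnot y$, $\lnot(x\vee y)\approx\lnot x\wedge\lnot y$ hold. It is *bipolarly absorptive* if it also satisfies $$x\wedge(x\vee\lnot x)\approx x\wedge(x\vee\lnot x)\wedge(x\vee\lnot x\vee y).$$ A *De Morgan lattice* is a De Morgan bisemilattice in which $\langle A,\wedge,\vee\rangle$ is a (distributive) lattice; $\mathcal{DML}$ is the variety of De Morgan lattices. $\mathbf{DM}_4$ is the four-element De Morgan lattice whose lattice is a four-element Boolean lattice, in which $\lnot$ interchanges top and bottom and fixes the other two elements. An *involutive semilattice* is a join semilattice $\langle I,\vee\rangle$ with an operation $\lnot$ such that $\lnot\lnot i=i$ and $\lnot(i\vee j)=\lnot i\vee\lnot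 j$; it is regarded as an algebra of type $\langle 2,2,1\rangle$ by letting $\wedge$ and $\vee$ both be the join. $\mathbf{IS}_3$ is the involutive semilattice on $\{\mathbf i,\lnot\mathbf i,\mathbf j\}$ in which $\mathbf i,\lnot\mathbf i$ are incomparable and $\mathbf j=\lnot\mathbf j$ is the top element. For a formula $\varphi$ let $Var^+(\varphi)$ (respectively $Var^-(\varphi)$) be the set of variables having an occurrence in $\varphi$ in the scope of an even (respectively odd) number of negations. An identity $\varphi\approx\psi$ is *bipolarly balanced* if either $Var^+(\varphi)\cap Var^-(\varphi)\neq\emptyset$ and $Var^+(\psi)\cap Var^-(\psi)\neq\emptyset$, or $Var^+(\varphi)=Var^+(\psi)$ and $Var^-(\varphi)=Var^-(\psi)$. $Bip(\mathcal{DML})$ is the class of all algebras that satisfy every bipolarly balanced identity valid in $\mathcal{DML}$. An *involutive semilattice direct system of distributive lattices* over an involutive semilattice $\mathbf I$ consists of non-empty distributive lattices $F(i)$ ($i\in I$), lattice homomorphisms $p_{ij}:F(i)\to F(j)$ for $i\le j$ with $p_{ii}=\mathrm{id}$ and $p_{jk}\circ p_{ij}=p_{ik}$, and maps $n_i:F(i)\to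 F(\lnot i)$ that interchange $\wedge$ and $\vee$, satisfy $n_{\lnot i}\circ n_i=\mathrm{id}$, and satisfy $n_j\circ p_{ij}=p_{\lnot i,\lnot j}\circ n_i$ for $i\le j$. Its *De Morgan–Płonka sum* is the disjoint union of the $F(i)$ with $a\ast b=p_{ik}(a)\ast p_{jk}(b)$ for $\ast\in\{\wedge,\vee\}$, $a\in F(i)$, $b\in F(j)$, $k=i\vee j$, and $\lnot a=n_i(a)$ for $a\in F(i)$. **Theorem.** The following classes of algebras are varieties and all coincide: 1. the class of bipolarly absorptive De Morgan bisemilattices; 2. $Bip(\mathcal{DML})$; 3. $V(\mathbf{DM}_4,\mathbf{IS}_3)$; 4. the class of algebras isomorphic to a De Morgan–Płonka sum of distributive lattices over a (non-empty) member of $V(\mathbf{IS}_3)$. Moreover, $Bip(\mathcal{DML})$ is indeed the variety that satisfies all and only the bipolarly balanced identities valid in $\mathcal{DML}$: an identity holds in $Bip(\mathcal{DML})$ if and only if it is bipolarly balanced and valid in $\mathcal{DML}$. -/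

import Mathlib

universe u

namespace DMPlonka

/-! ### Algebras of type ⟨2,2,1⟩ -/

/-- An algebra `⟨A, ∧, ∨, ¬⟩` of type `⟨2,2,1⟩`; universes of algebras are non-empty. -/
structure Alg : Type (u + 1) where
  carrier : Type u
  nonempty : Nonempty carrier
  inf : carrier → carrier → carrier
  sup : carrier → carrier → carrier
  neg : carrier → carrier

/-- Homomorphisms of algebras of type `⟨2,2,1⟩`. -/
structure IsHom (A B : Alg.{u}) (f : A.carrier → B.carrier) : Prop where
  map_inf : ∀ x y, f (A.inf x y) = B.inf (f x) (f y)
  map_sup : ∀ x y, f (A.sup x y) = B.sup (f x) (f y)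
  map_neg : ∀ x, f (A.neg x) = B.neg (f x)

/-- Isomorphism of algebras. -/
def IsIso (A B : Alg.{u}) : Prop :=
  ∃ f : A.carrier → B.carrier, IsHom A B f ∧ Function.Bijective f

/-- Direct product of a family of algebras, with the operations taken componentwise. -/
def Alg.prod {ι : Type u} (A : ι → Alg.{u}) : Alg.{u} where
  carrier := ∀ i, (A i).carrier
  nonempty := ⟨fun i => (A i).nonempty.some⟩
  inf x y := fun i => (A i).inf (x i) (y i)
  sup x y := fun i => (A i).sup (x i) (y i)
  neg x := fun i => (A i).neg (x i)

/-- A copy in an arbitrary universe of an algebra whose carrier is in `Type`. -/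
def Alg.lift (A : Alg.{0}) : Alg.{u} where
  carrier := ULift.{u} A.carrier
  nonempty := A.nonempty.map ULift.up
  inf x y := ⟨A.inf x.down y.down⟩
  sup x y := ⟨A.sup x.down y.down⟩
  neg x := ⟨A.neg x.down⟩

/-! ### Varieties -/

/-- A variety: a class of algebras closed under homomorphic images, (isomorphic copies of)
subalgebras, and direct products. It is non-empty, as it contains the empty product. -/
structure IsVariety (W : Set Alg.{u}) : Prop where
  closed_H : ∀ (A B : Alg.{u}) (f : A.carrier → B.carrier),
    A ∈ W → IsHom A B f → Function.Surjective f → B ∈ W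
  closed_S : ∀ (A B : Alg.{u}) (f : A.carrier → B.carrier),
    B ∈ W → IsHom A B f → Function.Injective f → A ∈ W
  closed_P : ∀ (ι : Type u) (A : ι → Alg.{u}), (∀ i, A i ∈ W) → Alg.prod A ∈ W

/-- `V(K)`: the smallest variety that contains the class `K`. -/
def generatedVariety (K : Set Alg.{u}) : Set Alg.{u} :=
  {A | ∀ W : Set Alg.{u}, IsVariety W → K ⊆ W → A ∈ W}

/-! ### Formulas and identities -/

/-- Formulas of type `⟨2,2,1⟩` over countably many variables. -/
inductive Fm : Type
  | var : ℕ → Fm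
  | inf : Fm → Fm → Fm
  | sup : Fm → Fm → Fm
  | neg : Fm → Fm

/-- The value of a formula under an assignment. -/
def Fm.eval (A : Alg.{u}) (h : ℕ → A.carrier) : Fm → A.carrier
  | .var n => h n
  | .inf s t => A.inf (s.eval A h) (t.eval A h)
  | .sup s t => A.sup (s.eval A h) (t.eval A h)
  | .neg s => A.neg (s.eval A h)

/-- `polVars true φ` is the set of variables with an occurrence in `φ` in the scope of an even
number of negations; `polVars false φ` is the same for an odd number. -/
def Fm.polVars : Bool → Fm → Finset ℕ
  | true, .var n => {n}
  | false, .var _ => ∅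
  | b, .inf s t => s.polVars b ∪ t.polVars b
  | b, .sup s t => s.polVars b ∪ t.polVars b
  | b, .neg s => s.polVars (!b)

/-- `Var⁺(φ)` -/
def Fm.posVars (φ : Fm) : Finset ℕ := φ.polVars true

/-- `Var⁻(φ)` -/
def Fm.negVars (φ : Fm) : Finset ℕ := φ.polVars false

/-- The algebra `A` satisfies the identity `φ ≈ ψ`. -/
def Sat (A : Alg.{u}) (φ ψ : Fm) : Prop :=
  ∀ h : ℕ → A.carrier, φ.eval A h = ψ.eval A h

/-- The class `K` satisfies the identity `φ ≈ ψ`. -/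
def ClassSat (K : Set Alg.{u}) (φ ψ : Fm) : Prop :=
  ∀ A ∈ K, Sat A φ ψ

/-- The identity `φ ≈ ψ` is balanced regular. -/
def BalancedRegular (φ ψ : Fm) : Prop :=
  φ.posVars = ψ.posVars ∧ φ.negVars = ψ.negVars

/-- The identity `φ ≈ ψ` is bipolar. -/
def Bipolar (φ ψ : Fm) : Prop :=
  (φ.posVars ∩ φ.negVars).Nonempty ∧ (ψ.posVars ∩ ψ.negVars).Nonempty

/-- The identity `φ ≈ ψ` is bipolarly balanced. -/
def BipolarlyBalanced (φ ψ : Fm) : Prop :=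
  Bipolar φ ψ ∨ BalancedRegular φ ψ

/-- `Bip(V)`: the class of models of the bipolarly balanced identities that are valid in `V`.
(If some variety satisfies all and only these identities, it is this one.) -/
def Bip (V : Set Alg.{u}) : Set Alg.{u} :=
  {A | ∀ φ ψ : Fm, BipolarlyBalanced φ ψ → ClassSat V φ ψ → Sat A φ ψ}

/-! ### De Morgan lattices and De Morgan bisemilattices -/

/-- `¬` is an involution that satisfies the De Morgan identities. -/
structure IsDeMorganNeg (A : Alg.{u}) : Prop where
  neg_neg : ∀ x, A.neg (A.neg x) = x
  neg_inf : ∀ x y, A.neg (A.inf x y) = A.sup (A.neg x) (A.neg y)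
  neg_sup : ∀ x y, A.neg (A.sup x y) = A.inf (A.neg x) (A.neg y)

/-- `⟨A, ∧, ∨⟩` is a distributive bisemilattice: both operations are idempotent, commutative and
associative, and each distributes over the other. -/
structure IsDistribBisemilattice (A : Alg.{u}) : Prop where
  inf_idem : ∀ x, A.inf x x = x
  inf_comm : ∀ x y, A.inf x y = A.inf y x
  inf_assoc : ∀ x y z, A.inf (A.inf x y) z = A.inf x (A.inf y z)
  sup_idem : ∀ x, A.sup x x = x
  sup_comm : ∀ x y, A.sup x y = A.sup y x
  sup_assoc : ∀ x y z, A.sup (A.sup x y) z = A.sup x (A.sup y z)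
  inf_sup_distrib : ∀ x y z, A.inf x (A.sup y z) = A.sup (A.inf x y) (A.inf x z)
  sup_inf_distrib : ∀ x y z, A.sup x (A.inf y z) = A.inf (A.sup x y) (A.sup x z)

/-- `⟨A, ∧, ∨⟩` is a distributive lattice: a distributive bisemilattice with both absorption
laws. -/
structure IsDistribLattice (A : Alg.{u}) : Prop extends IsDistribBisemilattice A where
  inf_absorb : ∀ x y, A.inf x (A.sup x y) = x
  sup_absorb : ∀ x y, A.sup x (A.inf x y) = x

/-- De Morgan lattices. -/
def DML : Set Alg.{u} := {A | IsDistribLattice A ∧ IsDeMorganNeg A}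

/-- De Morgan bisemilattices. -/
def DMBL : Set Alg.{u} := {A | IsDistribBisemilattice A ∧ IsDeMorganNeg A}

/-- The identity `x ∧ (x ∨ ¬x) ≈ x ∧ (x ∨ ¬x) ∧ (x ∨ ¬x ∨ y)`. -/
def BAbs (A : Alg.{u}) : Prop :=
  ∀ x y, A.inf x (A.sup x (A.neg x)) =
    A.inf (A.inf x (A.sup x (A.neg x))) (A.sup (A.sup x (A.neg x)) y)

/-- Bipolarly absorptive De Morgan bisemilattices. -/
def BDMBL : Set Alg.{u} := {A | A ∈ DMBL ∧ BAbs A}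

/-! ### The generators -/

/-- The four-element De Morgan lattice: the product order on `Bool × Bool`, with top element
`(true, true)` and bottom element `(false, false)`, which `¬` interchanges, while `¬` fixes
the two incomparable elements `(true, false)` and `(false, true)`. -/
def DM4 : Alg.{0} where
  carrier := Bool × Bool
  nonempty := ⟨(true, true)⟩
  inf x y := (x.1 && y.1, x.2 && y.2)
  sup x y := (x.1 || y.1, x.2 || y.2)
  neg x := (!x.2, !x.1)

/-- The elements `i`, `¬i`, `j` of the involutive semilattice `IS₃`. -/
inductive IS3Elem : Type
  | i
  | ni
  | j

/-- The join of `IS₃`: `i` and `¬i` are incomparable and `j` is the top element. -/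
def IS3Elem.join : IS3Elem → IS3Elem → IS3Elem
  | .i, .i => .i
  | .ni, .ni => .ni
  | _, _ => .j

/-- The involution of `IS₃`: it interchanges `i` and `¬i` and fixes `j`. -/
def IS3Elem.inv : IS3Elem → IS3Elem
  | .i => .ni
  | .ni => .i
  | .j => .j

/-- The involutive semilattice `IS₃`, as an algebra of type `⟨2,2,1⟩` in which `∧` and `∨`
are both the join. -/
def IS3 : Alg.{0} where
  carrier := IS3Elem
  nonempty := ⟨.j⟩
  inf := IS3Elem.join
  sup := IS3Elem.join
  neg := IS3Elem.inv

/-! ### De Morgan-Płonka sums of distributive lattices -/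

/-- Involutive semilattices: join semilattices with an involution that preserves joins. -/
class InvSemilattice (I : Type u) extends SemilatticeSup I where
  inv : I → I
  inv_inv : ∀ i, inv (inv i) = i
  inv_sup : ∀ i j, inv (i ⊔ j) = inv i ⊔ inv j

theorem InvSemilattice.inv_mono {I : Type u} [InvSemilattice I] {i j : I} (h : i ≤ j) :
    inv i ≤ inv j := by
  have h1 : inv (i ⊔ j) = inv i ⊔ inv j := inv_sup i j
  rw [sup_eq_right.mpr h] at h1
  exact sup_eq_right.mp h1.symm

/-- An involutive semilattice viewed as an algebra of type `⟨2,2,1⟩` in which `∧` and `∨` are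
both the join. -/
def InvSemilattice.toAlg (I : Type u) [InvSemilattice I] [hI : Nonempty I] : Alg.{u} where
  carrier := I
  nonempty := hI
  inf i j := i ⊔ j
  sup i j := i ⊔ j
  neg i := inv i

/-- An involutive semilattice direct system of (non-empty) distributive lattices over `I`, where
the type `⟨∧, ∨⟩` is dualised by interchanging `∧` and `∨`. -/
structure InvSystem (I : Type u) [InvSemilattice I] where
  /-- the fibres -/
  fibre : I → Type u
  fibreLattice : ∀ i, DistribLattice (fibre i)
  fibreNonempty : ∀ i, Nonempty (fibre i)
  /-- the transition maps, which are lattice homomorphisms -/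
  trans : ∀ {i j : I}, i ≤ j → LatticeHom (fibre i) (fibre j)
  trans_refl : ∀ (i : I) (a : fibre i), trans (le_refl i) a = a
  trans_trans : ∀ {i j k : I} (hij : i ≤ j) (hjk : j ≤ k) (a : fibre i),
    trans hjk (trans hij a) = trans (hij.trans hjk) a
  /-- the dualising maps, which are isomorphisms onto the dual of the fibre at `¬i` -/
  dual : ∀ i : I, fibre i → fibre (InvSemilattice.inv i)
  dual_inf : ∀ (i : I) (a b : fibre i), dual i (a ⊓ b) = dual i a ⊔ dual i b
  dual_sup : ∀ (i : I) (a b : fibre i), dual i (a ⊔ b) = dual i a ⊓ dual i b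
  /-- The dualising maps at `i` and at `¬i` are inverse to each other. The two sides are compared
  in the disjoint union of the fibres, as `¬¬i` and `i` are equal but not by definition. -/
  dual_dual : ∀ (i : I) (a : fibre i),
    (⟨InvSemilattice.inv (InvSemilattice.inv i), dual (InvSemilattice.inv i) (dual i a)⟩ :
      Σ k, fibre k) = ⟨i, a⟩
  dual_trans : ∀ {i j : I} (h : i ≤ j) (a : fibre i),
    dual j (trans h a) = trans (InvSemilattice.inv_mono h) (dual i a)

attribute [instance] InvSystem.fibreLattice

/-- The De Morgan-Płonka sum of an involutive semilattice direct system of distributive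
lattices. -/
def InvSystem.sum {I : Type u} [InvSemilattice I] [hI : Nonempty I] (F : InvSystem I) :
    Alg.{u} where
  carrier := Σ i, F.fibre i
  nonempty := ⟨⟨hI.some, (F.fibreNonempty hI.some).some⟩⟩
  inf x y := ⟨x.1 ⊔ y.1, F.trans le_sup_left x.2 ⊓ F.trans le_sup_right y.2⟩
  sup x y := ⟨x.1 ⊔ y.1, F.trans le_sup_left x.2 ⊔ F.trans le_sup_right y.2⟩
  neg x := ⟨InvSemilattice.inv x.1, F.dual x.1 x.2⟩

/-- The class of (algebras isomorphic to) De Morgan-Płonka sums of distributive lattices over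
involutive semilattices that belong to the class `K`. -/
def DMPlonkaSums (K : Set Alg.{u}) : Set Alg.{u} :=
  {A | ∃ (I : Type u) (_ : InvSemilattice I) (_ : Nonempty I) (F : InvSystem I),
    InvSemilattice.toAlg I ∈ K ∧ IsIso A F.sum}

end DMPlonka

/-!
Every De Morgan bisemilattice `A` is a De Morgan–Płonka sum of distributive lattices. The partition
function `x · y = x ∧ (x ∨ y)` is compatible with all operations (`neg_dot` for the negation); the
maps `z ↦ z · x` index the fibres, inside a fibre absorption holds, and multiplying by an element
of a larger index is the transition map (`plonkaSystem`, `isIso_plonkaSystem_sum`). Under this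
correspondence bipolar absorption says that `i ⊔ ¬i` is the top index for every index `i`
(`le_sup_inv_of_bAbs`, `InvSystem.sum_bAbs`).

Identities split accordingly. In an involutive semilattice a formula denotes the join of its
literals (`Fm.index_le_iff`), so `IS₃` satisfies only the bipolarly balanced identities
(`bipolarlyBalanced_of_sat_IS3`), and an involutive semilattice with every `i ⊔ ¬i` on top
satisfies all of them (`Fm.index_eq_of_bipolarlyBalanced`). If the two sides of an identity of `DM₄`
receive the same index `k` in a sum, they receive the same value (`InvSystem.eval_sum_eq`): a prime
filter `Q` of the fibre over `k` that separated the values would yield a refuting assignment in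
`DM₄`. The point is that the first coordinate of a value in `DM₄` depends on the first coordinate
of each positive literal and on the second coordinate of each negative one, so that the truth values
of `x` and `¬x` in `Q` can be prescribed independently. Hence `BDMBL` satisfies every bipolarly
balanced identity of `DM₄` (`sat_of_mem_BDMBL`), and so lies in `Bip(DML)`.

By Birkhoff's theorem (`mem_of_sat`) the algebras that satisfy all common identities of `DM₄` and
`IS₃` lie in the variety these generate; this yields the cycle
`BDMBL ⊆ Bip(DML) ⊆ V(DM₄, IS₃) ⊆ BDMBL`. The same theorem identifies the involutive semilattices
in `V(IS₃)` as those in which `i ⊔ ¬i` is always the top (`toAlg_mem_generatedVariety_IS3`), which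
turns the Płonka decomposition into the description of `BDMBL` as a class of sums.
-/

namespace DMPlonka

/-! ### The partition function of a De Morgan bisemilattice -/

/-- The partition function `x · y = x ∧ (x ∨ y)` of a distributive bisemilattice. In a Płonka sum
of lattices it carries `x` to the fibre whose index is the join of the indices of `x` and `y`. -/
def dot (A : Alg.{u}) (x y : A.carrier) : A.carrier := A.inf x (A.sup x y)

namespace IsDistribBisemilattice

variable {A : Alg.{u}} (hA : IsDistribBisemilattice A)
include hA

theorem std_instances : Std.Commutative A.inf ∧ Std.Associative A.inf ∧ Std.IdempotentOp A.inf ∧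
    Std.Commutative A.sup ∧ Std.Associative A.sup ∧ Std.IdempotentOp A.sup :=
  ⟨⟨hA.inf_comm⟩, ⟨hA.inf_assoc⟩, ⟨hA.inf_idem⟩, ⟨hA.sup_comm⟩, ⟨hA.sup_assoc⟩, ⟨hA.sup_idem⟩⟩

theorem dot_self (x : A.carrier) : dot A x x = x := by
  rw [dot, hA.sup_idem, hA.inf_idem]

theorem dot_eq_sup_inf (x y : A.carrier) : dot A x y = A.sup x (A.inf x y) := by
  rw [dot, hA.inf_sup_distrib, hA.inf_idem]

/-- Multiplying by `y ∧ z`, just as by `y ∨ z` or by `y · z`, is multiplying by `y` and then by `z`: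
the product depends on the right factor only through its index. -/
theorem dot_inf_right (x y z : A.carrier) : dot A x (A.inf y z) = dot A (dot A x y) z := by
  obtain ⟨_, _, _, _, _, _⟩ := hA.std_instances
  obtain ⟨_, _, _, _, _, _, _, _⟩ := hA
  simp only [dot]
  grind

theorem dot_sup_right (x y z : A.carrier) : dot A x (A.sup y z) = dot A (dot A x y) z := by
  obtain ⟨_, _, _, _, _, _⟩ := hA.std_instances
  obtain ⟨_, _, _, _, _, _, _, _⟩ := hA
  simp only [dot]
  grind

theorem inf_dot (x y z : A.carrier) :
    dot A (A.inf x y) z = A.inf (dot A x z) (dot A y z) := by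
  obtain ⟨_, _, _, _, _, _⟩ := hA.std_instances
  obtain ⟨_, _, _, _, _, _, _, _⟩ := hA
  simp only [dot]
  grind

theorem sup_dot (x y z : A.carrier) :
    dot A (A.sup x y) z = A.sup (dot A x z) (dot A y z) := by
  obtain ⟨_, _, _, _, _, _⟩ := hA.std_instances
  obtain ⟨_, _, _, _, _, _, _, _⟩ := hA
  simp only [dot]
  grind

theorem dot_dot_self (x y : A.carrier) : dot A (dot A x y) y = dot A x y := by
  rw [← hA.dot_inf_right, hA.inf_idem]

theorem dot_dot (x y z : A.carrier) : dot A x (dot A y z) = dot A (dot A x y) z := by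
  rw [dot.eq_def A y z, hA.dot_inf_right, hA.dot_sup_right, hA.dot_dot_self]

end IsDistribBisemilattice

theorem neg_dot {A : Alg.{u}} (hA : A ∈ DMBL) (x y : A.carrier) :
    A.neg (dot A x y) = dot A (A.neg x) (A.neg y) := by
  rw [hA.1.dot_eq_sup_inf, hA.2.neg_sup, hA.2.neg_inf, dot]

/-! ### The Płonka decomposition -/

/-- The set of indices of the Płonka decomposition: two elements have the same index when
multiplying by them on the right with respect to the partition function gives the same map. -/
def Index (A : Alg.{u}) : Type u := Quotient (Setoid.ker fun x z => dot A z x)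

/-- The index of an element in the Płonka decomposition. -/
def Index.mk {A : Alg.{u}} (x : A.carrier) : Index A := Quotient.mk _ x

theorem Index.mk_eq_mk {A : Alg.{u}} {x y : A.carrier} :
    Index.mk x = Index.mk y ↔ ∀ z, dot A z x = dot A z y :=
  Quotient.eq.trans funext_iff

/-- A representative of an index. -/
noncomputable def Index.rep {A : Alg.{u}} (i : Index A) : A.carrier := Quotient.out i

@[simp] theorem Index.mk_rep {A : Alg.{u}} (i : Index A) : Index.mk i.rep = i :=
  Quotient.out_eq i

theorem Index.dot_rep {A : Alg.{u}} {i : Index A} {y : A.carrier} (hy : Index.mk y = i)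
    (x : A.carrier) : dot A x i.rep = dot A x y :=
  Index.mk_eq_mk.1 ((Index.mk_rep i).trans hy.symm) x

theorem Index.ind {A : Alg.{u}} {p : Index A → Prop} (h : ∀ x, p (Index.mk x)) (i : Index A) :
    p i :=
  Quotient.ind h i

/-- The involutive semilattice of indices. -/
abbrev indexSemilattice {A : Alg.{u}} (hA : A ∈ DMBL) : InvSemilattice (Index A) :=
  letI : Max (Index A) := ⟨Quotient.map₂ A.inf fun x x' hx y y' hy => by
    rw [← Quotient.eq_iff_equiv] at hx hy ⊢
    refine Index.mk_eq_mk.2 fun z => ?_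
    rw [hA.1.dot_inf_right, hA.1.dot_inf_right, Index.mk_eq_mk.1 hx, Index.mk_eq_mk.1 hy]⟩
  { SemilatticeSup.mk'
      (Index.ind fun x => Index.ind fun y => congrArg Index.mk (hA.1.inf_comm x y))
      (Index.ind fun x => Index.ind fun y => Index.ind fun z =>
        congrArg Index.mk (hA.1.inf_assoc x y z))
      (Index.ind fun x => congrArg Index.mk (hA.1.inf_idem x)) with
    inv := Quotient.map A.neg fun x x' hx => by
      rw [← Quotient.eq_iff_equiv] at hx ⊢
      refine Index.mk_eq_mk.2 fun z => ?_
      rw [← hA.2.neg_neg z, ← neg_dot hA, ← neg_dot hA, Index.mk_eq_mk.1 hx]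
    inv_inv := Index.ind fun x => congrArg Index.mk (hA.2.neg_neg x)
    inv_sup := Index.ind fun x => Index.ind fun y => by
      refine Index.mk_eq_mk.2 fun z => ?_
      rw [hA.2.neg_inf, hA.1.dot_sup_right, hA.1.dot_inf_right] }

section Decomposition

variable {A : Alg.{u}} (hA : A ∈ DMBL)

theorem mk_inf (x y : A.carrier) :
    letI := indexSemilattice hA
    Index.mk (A.inf x y) = Index.mk x ⊔ Index.mk y := rfl

theorem mk_neg (x : A.carrier) :
    letI := indexSemilattice hA
    Index.mk (A.neg x) = InvSemilattice.inv (Index.mk x) := rfl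

theorem mk_sup (x y : A.carrier) :
    letI := indexSemilattice hA
    Index.mk (A.sup x y) = Index.mk x ⊔ Index.mk y := by
  rw [← mk_inf hA]
  refine Index.mk_eq_mk.2 fun z => ?_
  rw [hA.1.dot_sup_right, hA.1.dot_inf_right]

theorem mk_dot (x y : A.carrier) :
    letI := indexSemilattice hA
    Index.mk (dot A x y) = Index.mk x ⊔ Index.mk y := by
  rw [← mk_inf hA]
  refine Index.mk_eq_mk.2 fun z => ?_
  rw [hA.1.dot_dot, hA.1.dot_inf_right]

/-- The elements of a given index form a distributive lattice: absorption holds because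
`x ∧ (x ∨ y) = x · y = x · x` when `x` and `y` have the same index. -/
abbrev fibreDistribLattice (i : Index A) : DistribLattice {a : A.carrier // Index.mk a = i} :=
  letI := indexSemilattice hA
  letI : Min {a : A.carrier // Index.mk a = i} :=
    ⟨fun a b => ⟨A.inf a b, by rw [mk_inf hA, a.2, b.2, sup_idem]⟩⟩
  letI : Max {a : A.carrier // Index.mk a = i} :=
    ⟨fun a b => ⟨A.sup a b, by rw [mk_sup hA, a.2, b.2, sup_idem]⟩⟩
  have hdot : ∀ a b : {a : A.carrier // Index.mk a = i}, dot A a b = a := fun a b => by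
    rw [Index.mk_eq_mk.1 (b.2.trans a.2.symm), hA.1.dot_self]
  letI : Lattice {a : A.carrier // Index.mk a = i} :=
    Lattice.mk' (fun a b => Subtype.ext (hA.1.sup_comm a b))
      (fun a b c => Subtype.ext (hA.1.sup_assoc a b c))
      (fun a b => Subtype.ext (hA.1.inf_comm a b))
      (fun a b c => Subtype.ext (hA.1.inf_assoc a b c))
      (fun a b => Subtype.ext ((hA.1.dot_eq_sup_inf a b).symm.trans (hdot a b)))
      (fun a b => Subtype.ext (hdot a b))
  { (inferInstance : Lattice {a : A.carrier // Index.mk a = i}) with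
    le_sup_inf := fun a b c =>
      (Subtype.ext (hA.1.sup_inf_distrib a b c).symm : (a ⊔ b) ⊓ (a ⊔ c) = a ⊔ b ⊓ c).le }

theorem sigma_ext_val {i j : Index A} {a : {a : A.carrier // Index.mk a = i}}
    {b : {a : A.carrier // Index.mk a = j}} (h : (a : A.carrier) = b) :
    (⟨i, a⟩ : Σ i : Index A, {a : A.carrier // Index.mk a = i}) = ⟨j, b⟩ := by
  obtain ⟨a, rfl⟩ := a
  obtain ⟨b, rfl⟩ := b
  subst h
  rfl

/-- The Płonka decomposition of a De Morgan bisemilattice. The transition map to the fibre of `j`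
is multiplication by any element of index `j` with respect to the partition function. -/
noncomputable abbrev plonkaSystem : @InvSystem (Index A) (indexSemilattice hA) :=
  letI := indexSemilattice hA
  { fibre := fun i => {a : A.carrier // Index.mk a = i}
    fibreLattice := fibreDistribLattice hA
    fibreNonempty := fun i => ⟨⟨i.rep, i.mk_rep⟩⟩
    trans := fun {i j} hij =>
      letI := fibreDistribLattice hA
      { toFun := fun a => ⟨dot A a j.rep, by
          rw [mk_dot hA, a.2, Index.mk_rep, sup_eq_right.2 hij]⟩
        map_sup' := fun a b => Subtype.ext (hA.1.sup_dot a b j.rep)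
        map_inf' := fun a b => Subtype.ext (hA.1.inf_dot a b j.rep) }
    trans_refl := fun i a => Subtype.ext <|
      (Index.dot_rep a.2 _).trans (hA.1.dot_self _)
    trans_trans := fun {i j k} hij hjk a => Subtype.ext <| by
      change dot A (dot A a j.rep) k.rep = dot A a k.rep
      rw [← hA.1.dot_inf_right, eq_comm]
      exact Index.dot_rep (by
        rw [mk_inf hA, Index.mk_rep, Index.mk_rep, sup_eq_right.2 hjk]) _
    dual := fun i a => ⟨A.neg a, by rw [mk_neg hA, a.2]⟩
    dual_inf := fun i a b => Subtype.ext (hA.2.neg_inf a b)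
    dual_sup := fun i a b => Subtype.ext (hA.2.neg_sup a b)
    dual_dual := fun i a => sigma_ext_val (hA.2.neg_neg a)
    dual_trans := fun {i j} h a => Subtype.ext <| by
      change A.neg (dot A a j.rep) = dot A (A.neg a) _
      rw [neg_dot hA]
      exact (Index.dot_rep (by rw [mk_neg hA, Index.mk_rep]) _).symm }

theorem index_nonempty (A : Alg.{u}) : Nonempty (Index A) := A.nonempty.map Index.mk

theorem isIso_plonkaSystem_sum :
    letI := indexSemilattice hA
    letI := index_nonempty A
    IsIso A (plonkaSystem hA).sum := by
  let := indexSemilattice hA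
  let := index_nonempty A
  refine ⟨fun x => ⟨Index.mk x, x, rfl⟩, ⟨fun x y => ?_, fun x y => ?_, fun x => ?_⟩, ?_, ?_⟩
  · refine sigma_ext_val ?_
    change A.inf x y = A.inf (dot A x _) (dot A y _)
    rw [← hA.1.inf_dot, Index.dot_rep (mk_inf hA x y), hA.1.dot_self]
  · refine sigma_ext_val ?_
    change A.sup x y = A.sup (dot A x _) (dot A y _)
    rw [← hA.1.sup_dot, Index.dot_rep (mk_sup hA x y), hA.1.dot_self]
  · rfl
  · intro x y h
    exact congrArg (fun p : Σ i : Index A, {a : A.carrier // Index.mk a = i} => (p.2 : A.carrier)) h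
  · rintro ⟨_, x, rfl⟩
    exact ⟨x, rfl⟩

/-- Bipolar absorption says that every join `i ⊔ ¬i` of indices is the top index. -/
theorem le_sup_inv_of_bAbs (h : BAbs A) :
    letI := indexSemilattice hA
    ∀ i j : Index A, j ≤ i ⊔ InvSemilattice.inv i := by
  let := indexSemilattice hA
  refine Index.ind fun x => Index.ind fun y => ?_
  have := congrArg Index.mk (h x y)
  simp only [mk_inf hA, mk_sup hA, mk_neg hA] at this
  calc _ ≤ _ := le_sup_right.trans le_sup_right
    _ = _ := this.symm
    _ = _ := by rw [← sup_assoc, sup_idem]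

end Decomposition

/-! ### De Morgan–Płonka sums are De Morgan bisemilattices -/

namespace InvSystem

variable {I : Type u} [InvSemilattice I] (F : InvSystem I)

theorem sigma_ext {i j : I} {a : F.fibre i} {b : F.fibre j} (h : i = j)
    (h' : F.trans h.le a = b) : (⟨i, a⟩ : Σ i, F.fibre i) = ⟨j, b⟩ := by
  subst h
  exact congrArg _ ((F.trans_refl i a).symm.trans h')

theorem sum_mem_DMBL [Nonempty I] : F.sum ∈ DMBL := by
  refine ⟨⟨?_, ?_, ?_, ?_, ?_, ?_, ?_, ?_⟩, ⟨?_, ?_, ?_⟩⟩ <;> dsimp only [sum]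
  · rintro ⟨i, a⟩
    refine F.sigma_ext (sup_idem _) ?_
    simp [F.trans_trans, F.trans_refl]
  · rintro ⟨i, a⟩ ⟨j, b⟩
    refine F.sigma_ext (sup_comm _ _) ?_
    simp [F.trans_trans, inf_comm]
  · rintro ⟨i, a⟩ ⟨j, b⟩ ⟨k, c⟩
    refine F.sigma_ext (sup_assoc _ _ _) ?_
    simp [F.trans_trans, inf_assoc]
  · rintro ⟨i, a⟩
    refine F.sigma_ext (sup_idem _) ?_
    simp [F.trans_trans, F.trans_refl]
  · rintro ⟨i, a⟩ ⟨j, b⟩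
    refine F.sigma_ext (sup_comm _ _) ?_
    simp [F.trans_trans, sup_comm]
  · rintro ⟨i, a⟩ ⟨j, b⟩ ⟨k, c⟩
    refine F.sigma_ext (sup_assoc _ _ _) ?_
    simp [F.trans_trans, sup_assoc]
  · rintro ⟨i, a⟩ ⟨j, b⟩ ⟨k, c⟩
    refine F.sigma_ext (sup_sup_distrib_left _ _ _) ?_
    simp [F.trans_trans, inf_sup_left]
  · rintro ⟨i, a⟩ ⟨j, b⟩ ⟨k, c⟩
    refine F.sigma_ext (sup_sup_distrib_left _ _ _) ?_
    simp [F.trans_trans, sup_inf_left]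
  · rintro ⟨i, a⟩
    exact F.dual_dual i a
  · rintro ⟨i, a⟩ ⟨j, b⟩
    refine F.sigma_ext (InvSemilattice.inv_sup _ _) ?_
    simp [F.trans_trans, F.dual_inf, F.dual_trans]
  · rintro ⟨i, a⟩ ⟨j, b⟩
    refine F.sigma_ext (InvSemilattice.inv_sup _ _) ?_
    simp [F.trans_trans, F.dual_sup, F.dual_trans]

theorem sum_bAbs [Nonempty I] (h : ∀ i j : I, j ≤ i ⊔ InvSemilattice.inv i) : BAbs F.sum := by
  dsimp only [BAbs, sum]
  rintro ⟨i, a⟩ ⟨j, b⟩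
  have e : i ⊔ (i ⊔ InvSemilattice.inv i) ⊔ (i ⊔ InvSemilattice.inv i ⊔ j) =
      i ⊔ (i ⊔ InvSemilattice.inv i) := by
    rw [sup_eq_left.2 (h i j), ← sup_assoc i i, sup_idem, sup_idem]
  refine F.sigma_ext e.symm ?_
  simp only [F.trans_trans, map_inf, map_sup]
  rw [inf_assoc, inf_sup_self, inf_sup_self, inf_sup_self]

end InvSystem

/-! ### Identities in involutive semilattices -/

theorem InvSemilattice.inv_le_iff {I : Type u} [InvSemilattice I] {i j : I} :
    inv i ≤ j ↔ i ≤ inv j :=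
  ⟨fun h => inv_inv i ▸ inv_mono h, fun h => inv_inv j ▸ inv_mono h⟩

/-- The value of a formula in an involutive semilattice, with `∧` and `∨` both the join. -/
def Fm.index {I : Type u} [InvSemilattice I] (h : ℕ → I) : Fm → I
  | .var n => h n
  | .inf s t => s.index h ⊔ t.index h
  | .sup s t => s.index h ⊔ t.index h
  | .neg s => InvSemilattice.inv (s.index h)

theorem Fm.eval_toAlg {I : Type u} [InvSemilattice I] [Nonempty I] (h : ℕ → I) (φ : Fm) :
    φ.eval (InvSemilattice.toAlg I) h = φ.index h := by
  induction φ with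
  | var n => rfl
  | inf s t hs ht => exact congrArg₂ (InvSemilattice.toAlg I).sup hs ht
  | sup s t hs ht => exact congrArg₂ (InvSemilattice.toAlg I).sup hs ht
  | neg s hs => exact congrArg (InvSemilattice.toAlg I).neg hs

/-- In an involutive semilattice the value of a formula is the join of the values of its
literals. -/
theorem Fm.index_le_iff {I : Type u} [InvSemilattice I] (h : ℕ → I) (φ : Fm) (k : I) :
    φ.index h ≤ k ↔
      (∀ n ∈ φ.posVars, h n ≤ k) ∧ ∀ n ∈ φ.negVars, InvSemilattice.inv (h n) ≤ k := by
  simp only [Fm.posVars, Fm.negVars]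
  induction φ generalizing k with
  | var n => simp [Fm.index, Fm.polVars]
  | inf s t hs ht =>
    simp only [Fm.index, Fm.polVars, Finset.forall_mem_union, sup_le_iff, hs, ht]
    tauto
  | sup s t hs ht =>
    simp only [Fm.index, Fm.polVars, Finset.forall_mem_union, sup_le_iff, hs, ht]
    tauto
  | neg s hs =>
    simp only [Fm.index, Fm.polVars, Bool.not_true, Bool.not_false, InvSemilattice.inv_le_iff, hs,
      InvSemilattice.inv_inv]
    tauto

theorem Fm.index_eq_of_bipolarlyBalanced {I : Type u} [InvSemilattice I]
    (htop : ∀ i j : I, j ≤ i ⊔ InvSemilattice.inv i) {φ ψ : Fm} (hb : BipolarlyBalanced φ ψ)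
    (h : ℕ → I) : φ.index h = ψ.index h := by
  rcases hb with ⟨hφ, hψ⟩ | ⟨hp, hn⟩
  · -- Complementary literals make the value the top element.
    have key : ∀ χ : Fm, (χ.posVars ∩ χ.negVars).Nonempty → ∀ j : I, j ≤ χ.index h := by
      rintro χ ⟨n, hn⟩ j
      obtain ⟨h₁, h₂⟩ := (χ.index_le_iff h _).1 le_rfl
      rw [Finset.mem_inter] at hn
      exact (htop (h n) j).trans (sup_le (h₁ n hn.1) (h₂ n hn.2))
    exact le_antisymm (key ψ hψ _) (key φ hφ _)
  · refine eq_of_forall_ge_iff fun k => ?_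
    rw [Fm.index_le_iff, Fm.index_le_iff, hp, hn]

/-- `IS₃` as an involutive semilattice. -/
instance : InvSemilattice IS3Elem where
  __ := @SemilatticeSup.mk' IS3Elem ⟨IS3Elem.join⟩
    (by rintro (_ | _ | _) (_ | _ | _) <;> rfl)
    (by rintro (_ | _ | _) (_ | _ | _) (_ | _ | _) <;> rfl)
    (by rintro (_ | _ | _) <;> rfl)
  inv := IS3Elem.inv
  inv_inv := by rintro (_ | _ | _) <;> rfl
  inv_sup := by rintro (_ | _ | _) (_ | _ | _) <;> rfl

instance : Nonempty IS3Elem := ⟨.j⟩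

theorem IS3Elem.le_iff {a b : IS3Elem} : a ≤ b ↔ a = b ∨ b = .j := by
  change IS3Elem.join a b = b ↔ _
  rcases a with _ | _ | _ <;> rcases b with _ | _ | _ <;> simp [IS3Elem.join]

/-- If no variable of `φ` occurs with both polarities, send its positive variables to `i`, its
negative ones to `¬i` and all others to `j`. Then `φ` has the value `i`, and another formula has
the value `i` only if its literals are among those of `φ`. -/
theorem vars_subset_of_sat_IS3 {φ ψ : Fm} (hs : Sat IS3 φ ψ)
    (hφ : ¬ (φ.posVars ∩ φ.negVars).Nonempty) :
    ψ.posVars ⊆ φ.posVars ∧ ψ.negVars ⊆ φ.negVars := by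
  rw [Finset.not_nonempty_iff_eq_empty, ← Finset.disjoint_iff_inter_eq_empty,
    Finset.disjoint_left] at hφ
  let h : ℕ → IS3Elem := fun n =>
    if n ∈ φ.posVars then .i else if n ∈ φ.negVars then .ni else .j
  have h₁ : φ.index h ≤ .i := by
    refine (φ.index_le_iff h _).2 ⟨fun n hn => ?_, fun n hn => ?_⟩
    · simp [h, hn]
    · have hn' : n ∉ φ.posVars := fun hp => hφ hp hn
      simp only [h, hn, hn', if_true, if_false]
      exact le_refl IS3Elem.i
  have h₂ : ψ.index h ≤ .i := by
    have : φ.index h = ψ.index h := by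
      rw [← Fm.eval_toAlg, ← Fm.eval_toAlg]
      exact hs h
    exact this.ge.trans h₁
  obtain ⟨hp, hn⟩ := (ψ.index_le_iff h _).1 h₂
  refine ⟨fun n hn' => ?_, fun n hn' => ?_⟩
  · have := IS3Elem.le_iff.1 (hp n hn')
    by_contra hc
    simp only [h, hc, if_false] at this
    split_ifs at this <;> simp at this
  · have := IS3Elem.le_iff.1 (hn n hn')
    by_contra hc
    simp only [h, hc, if_false, InvSemilattice.inv] at this
    split_ifs at this <;> simp [IS3Elem.inv] at this

theorem bipolarlyBalanced_of_sat_IS3 {φ ψ : Fm} (hs : Sat IS3 φ ψ) : BipolarlyBalanced φ ψ := by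
  have hs' : Sat IS3 ψ φ := fun h => (hs h).symm
  by_cases hφ : (φ.posVars ∩ φ.negVars).Nonempty
  · by_cases hψ : (ψ.posVars ∩ ψ.negVars).Nonempty
    · exact Or.inl ⟨hφ, hψ⟩
    · obtain ⟨h₁, h₂⟩ := vars_subset_of_sat_IS3 hs' hψ
      exact absurd (hφ.mono (Finset.inter_subset_inter h₁ h₂)) hψ
  · obtain ⟨h₁, h₂⟩ := vars_subset_of_sat_IS3 hs hφ
    have hψ : ¬ (ψ.posVars ∩ ψ.negVars).Nonempty := fun hψ =>
      hφ (hψ.mono (Finset.inter_subset_inter h₁ h₂))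
    obtain ⟨h₃, h₄⟩ := vars_subset_of_sat_IS3 hs' hψ
    exact Or.inr ⟨h₃.antisymm h₁, h₄.antisymm h₂⟩

/-! ### Identities of DM₄ in De Morgan–Płonka sums -/

/-- Prime ideal separation in a distributive lattice, stated for the characteristic function of
the complementary prime filter. -/
theorem exists_latticeHom_bool_ne {L : Type u} [DistribLattice L] {a b : L} (hab : a ≠ b) :
    ∃ χ : L → Bool, (∀ x y, χ (x ⊓ y) = (χ x && χ y)) ∧ (∀ x y, χ (x ⊔ y) = (χ x || χ y)) ∧
      χ a ≠ χ b := by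
  classical
  wlog hle : ¬ a ≤ b generalizing a b
  · obtain ⟨χ, h₁, h₂, h₃⟩ := this hab.symm fun h => hab (le_antisymm (not_not.1 hle) h)
    exact ⟨χ, h₁, h₂, h₃.symm⟩
  obtain ⟨J, hJ, hIJ, hFJ⟩ := DistribLattice.prime_ideal_of_disjoint_filter_ideal
    (F := Order.PFilter.principal a) (I := Order.Ideal.principal b)
    (Set.disjoint_left.2 fun x hx hx' => hle
      ((Order.PFilter.mem_principal.1 hx).trans (Order.Ideal.mem_principal.1 hx')))
  refine ⟨fun x => decide (x ∉ J), fun x y => ?_, fun x y => ?_, ?_⟩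
  · have : x ⊓ y ∈ J ↔ x ∈ J ∨ y ∈ J :=
      ⟨hJ.mem_or_mem, fun h => h.elim (J.lower inf_le_left) (J.lower inf_le_right)⟩
    simp [this]
  · simp [Order.Ideal.sup_mem_iff]
  · have ha : a ∉ J := Set.disjoint_left.1 hFJ (Order.PFilter.mem_principal.2 le_rfl)
    have hb : b ∈ J := hIJ (Order.Ideal.mem_principal.2 le_rfl)
    simp [ha, hb]

namespace InvSystem

variable {I : Type u} [InvSemilattice I] [Nonempty I] (F : InvSystem I)

theorem eval_sum_fst (h : ℕ → F.sum.carrier) (φ : Fm) :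
    (φ.eval F.sum h).1 = φ.index fun n => (h n).1 := by
  induction φ with
  | var n => rfl
  | inf s t hs ht => exact congrArg₂ (· ⊔ ·) hs ht
  | sup s t hs ht => exact congrArg₂ (· ⊔ ·) hs ht
  | neg s hs => exact congrArg InvSemilattice.inv hs

open Classical in
/-- The truth value of an element `x` of the sum with respect to a truth valuation `χ` of the
fibre over `k`. It is only meaningful when the index of `x` is at most `k`. -/
noncomputable def truth {k : I} (χ : F.fibre k → Bool) (x : Σ i, F.fibre i) : Bool :=
  if h : x.1 ≤ k then χ (F.trans h x.2) else false

theorem truth_inf {k : I} {χ : F.fibre k → Bool} (hχ : ∀ x y, χ (x ⊓ y) = (χ x && χ y))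
    {x y : F.sum.carrier} (h : (F.sum.inf x y).1 ≤ k) :
    F.truth χ (F.sum.inf x y) = (F.truth χ x && F.truth χ y) := by
  obtain ⟨i, a⟩ := x
  obtain ⟨j, b⟩ := y
  have h' : i ⊔ j ≤ k := h
  have hi : i ≤ k := le_sup_left.trans h'
  have hj : j ≤ k := le_sup_right.trans h'
  unfold truth
  rw [dif_pos h, dif_pos hi, dif_pos hj]
  change χ (F.trans h' (F.trans le_sup_left a ⊓ F.trans le_sup_right b)) = _
  rw [map_inf, hχ, F.trans_trans, F.trans_trans]

theorem truth_sup {k : I} {χ : F.fibre k → Bool} (hχ : ∀ x y, χ (x ⊔ y) = (χ x || χ y))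
    {x y : F.sum.carrier} (h : (F.sum.sup x y).1 ≤ k) :
    F.truth χ (F.sum.sup x y) = (F.truth χ x || F.truth χ y) := by
  obtain ⟨i, a⟩ := x
  obtain ⟨j, b⟩ := y
  have h' : i ⊔ j ≤ k := h
  have hi : i ≤ k := le_sup_left.trans h'
  have hj : j ≤ k := le_sup_right.trans h'
  unfold truth
  rw [dif_pos h, dif_pos hi, dif_pos hj]
  change χ (F.trans h' (F.trans le_sup_left a ⊔ F.trans le_sup_right b)) = _
  rw [map_sup, hχ, F.trans_trans, F.trans_trans]

/-- The assignment in `DM₄` that records, in the first coordinate, the truth value of `h n` and,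
in the second one, the negation of the truth value of `¬(h n)`, represents the truth values of
all formulas whose index is at most `k`. The two coordinates are unrelated, so it does not matter
whether both `h n` and `¬(h n)` have an index at most `k`. -/
theorem truth_eval {k : I} {χ : F.fibre k → Bool} (hinf : ∀ x y, χ (x ⊓ y) = (χ x && χ y))
    (hsup : ∀ x y, χ (x ⊔ y) = (χ x || χ y)) (h : ℕ → F.sum.carrier) (φ : Fm) :
    ((φ.eval F.sum h).1 ≤ k → F.truth χ (φ.eval F.sum h) =
      (φ.eval DM4 fun n => (F.truth χ (h n), !F.truth χ (F.sum.neg (h n)))).1) ∧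
    ((F.sum.neg (φ.eval F.sum h)).1 ≤ k → F.truth χ (F.sum.neg (φ.eval F.sum h)) =
      !(φ.eval DM4 fun n => (F.truth χ (h n), !F.truth χ (F.sum.neg (h n)))).2) := by
  obtain ⟨hS, hN⟩ := F.sum_mem_DMBL
  induction φ with
  | var n => simp [Fm.eval]
  | inf s t hs ht =>
    refine ⟨fun hk => ?_, fun hk => ?_⟩
    · simp only [Fm.eval] at hk ⊢
      rw [F.truth_inf hinf hk, hs.1 (le_sup_left.trans hk), ht.1 (le_sup_right.trans hk)]
      rfl
    · simp only [Fm.eval] at hk ⊢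
      rw [hN.neg_inf] at hk ⊢
      rw [F.truth_sup hsup hk, hs.2 (le_sup_left.trans hk), ht.2 (le_sup_right.trans hk),
        ← Bool.not_and]
      rfl
  | sup s t hs ht =>
    refine ⟨fun hk => ?_, fun hk => ?_⟩
    · simp only [Fm.eval] at hk ⊢
      rw [F.truth_sup hsup hk, hs.1 (le_sup_left.trans hk), ht.1 (le_sup_right.trans hk)]
      rfl
    · simp only [Fm.eval] at hk ⊢
      rw [hN.neg_sup] at hk ⊢
      rw [F.truth_inf hinf hk, hs.2 (le_sup_left.trans hk), ht.2 (le_sup_right.trans hk),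
        ← Bool.not_or]
      rfl
  | neg s hs =>
    refine ⟨fun hk => hs.2 hk, fun hk => ?_⟩
    simp only [Fm.eval] at hk ⊢
    rw [hN.neg_neg] at hk ⊢
    rw [hs.1 hk]
    exact (Bool.not_not _).symm

/-- An identity of `DM₄` holds in a De Morgan–Płonka sum under every assignment that gives its two
sides the same index: otherwise a prime filter of the fibre of that index separates the two
values. -/
theorem eval_sum_eq {φ ψ : Fm} (hs : Sat DM4 φ ψ) (h : ℕ → F.sum.carrier)
    (hi : (φ.eval F.sum h).1 = (ψ.eval F.sum h).1) : φ.eval F.sum h = ψ.eval F.sum h := by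
  by_contra hne
  obtain ⟨χ, hinf, hsup, hχ⟩ := exists_latticeHom_bool_ne
    (a := F.trans hi.le (φ.eval F.sum h).2) (b := (ψ.eval F.sum h).2)
    fun h' => hne (F.sigma_ext hi h')
  refine hχ ?_
  have h₁ := (F.truth_eval hinf hsup h φ).1 hi.le
  have h₂ := (F.truth_eval hinf hsup h ψ).1 le_rfl
  simpa [truth, hi, F.trans_refl] using h₁.trans ((congrArg Prod.fst (hs _)).trans h₂.symm)

end InvSystem

/-! ### Varieties and identities -/

theorem IsHom.map_eval {A B : Alg.{u}} {f : A.carrier → B.carrier} (hf : IsHom A B f)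
    (h : ℕ → A.carrier) (φ : Fm) : f (φ.eval A h) = φ.eval B fun n => f (h n) := by
  induction φ with
  | var n => rfl
  | inf s t hs ht => simp only [Fm.eval, hf.map_inf, hs, ht]
  | sup s t hs ht => simp only [Fm.eval, hf.map_sup, hs, ht]
  | neg s hs => simp only [Fm.eval, hf.map_neg, hs]

theorem Sat.of_injective {A B : Alg.{u}} {f : A.carrier → B.carrier} (hf : IsHom A B f)
    (hi : Function.Injective f) {φ ψ : Fm} (h : Sat B φ ψ) : Sat A φ ψ := fun g =>
  hi <| by rw [hf.map_eval, hf.map_eval, h]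

theorem eval_lift (A : Alg.{0}) (h : ℕ → (Alg.lift.{u} A).carrier) (φ : Fm) :
    φ.eval A.lift h = ⟨φ.eval A fun n => (h n).down⟩ := by
  induction φ with
  | var n => rfl
  | inf s t hs ht => simp only [Fm.eval, hs, ht]; rfl
  | sup s t hs ht => simp only [Fm.eval, hs, ht]; rfl
  | neg s hs => simp only [Fm.eval, hs]; rfl

theorem sat_lift {A : Alg.{0}} {φ ψ : Fm} : Sat (Alg.lift.{u} A) φ ψ ↔ Sat A φ ψ := by
  refine ⟨fun h g => ?_, fun h g => ?_⟩
  · have := (eval_lift.{u} A (fun n => ⟨g n⟩) φ).symm.trans ((h _).trans (eval_lift A _ ψ))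
    exact congrArg ULift.down this
  · rw [eval_lift, eval_lift, h]

theorem isVariety_generatedVariety (K : Set Alg.{u}) : IsVariety (generatedVariety K) where
  closed_H A B f hA hf hs W hW hK := hW.closed_H A B f (hA W hW hK) hf hs
  closed_S A B f hB hf hi W hW hK := hW.closed_S A B f (hB W hW hK) hf hi
  closed_P ι A hA W hW hK := hW.closed_P ι A fun i => hA i W hW hK

theorem subset_generatedVariety (K : Set Alg.{u}) : K ⊆ generatedVariety K :=
  fun _ hA _ _ hK => hK hA

theorem isVariety_DMBL : IsVariety DMBL.{u} where
  closed_H := by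
    rintro A B f ⟨⟨a, b, c, d, e, k, l, m⟩, ⟨n, o, p⟩⟩ ⟨hi, hs, hn⟩ hf
    refine ⟨⟨?_, ?_, ?_, ?_, ?_, ?_, ?_, ?_⟩, ⟨?_, ?_, ?_⟩⟩ <;>
      simp only [hf.forall, ← hi, ← hs, ← hn]
    exacts [fun _ => congrArg f (a _), fun _ _ => congrArg f (b _ _),
      fun _ _ _ => congrArg f (c _ _ _), fun _ => congrArg f (d _), fun _ _ => congrArg f (e _ _),
      fun _ _ _ => congrArg f (k _ _ _), fun _ _ _ => congrArg f (l _ _ _),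
      fun _ _ _ => congrArg f (m _ _ _), fun _ => congrArg f (n _), fun _ _ => congrArg f (o _ _),
      fun _ _ => congrArg f (p _ _)]
  closed_S := by
    rintro A B f ⟨⟨a, b, c, d, e, k, l, m⟩, ⟨n, o, p⟩⟩ ⟨hi, hs, hn⟩ hf
    refine ⟨⟨?_, ?_, ?_, ?_, ?_, ?_, ?_, ?_⟩, ⟨?_, ?_, ?_⟩⟩ <;> intros <;> apply hf <;>
      simp only [hi, hs, hn]
    exacts [a _, b _ _, c _ _ _, d _, e _ _, k _ _ _, l _ _ _, m _ _ _, n _, o _ _, p _ _]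
  closed_P ι A h :=
    ⟨⟨fun x => funext fun i => (h i).1.inf_idem _, fun x y => funext fun i => (h i).1.inf_comm _ _,
      fun x y z => funext fun i => (h i).1.inf_assoc _ _ _,
      fun x => funext fun i => (h i).1.sup_idem _, fun x y => funext fun i => (h i).1.sup_comm _ _,
      fun x y z => funext fun i => (h i).1.sup_assoc _ _ _,
      fun x y z => funext fun i => (h i).1.inf_sup_distrib _ _ _,
      fun x y z => funext fun i => (h i).1.sup_inf_distrib _ _ _⟩,
     ⟨fun x => funext fun i => (h i).2.neg_neg _, fun x y => funext fun i => (h i).2.neg_inf _ _,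
      fun x y => funext fun i => (h i).2.neg_sup _ _⟩⟩

theorem isVariety_BDMBL : IsVariety BDMBL.{u} where
  closed_H A B f hA hf hs := by
    refine ⟨isVariety_DMBL.closed_H A B f hA.1 hf hs, ?_⟩
    simp only [BAbs, hs.forall, ← hf.map_inf, ← hf.map_sup, ← hf.map_neg]
    exact fun x y => congrArg f (hA.2 x y)
  closed_S A B f hB hf hi := by
    refine ⟨isVariety_DMBL.closed_S A B f hB.1 hf hi, fun x y => hi ?_⟩
    simp only [hf.map_inf, hf.map_sup, hf.map_neg]
    exact hB.2 _ _
  closed_P ι A h :=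
    ⟨isVariety_DMBL.closed_P ι A fun i => (h i).1, fun _ _ => funext fun i => (h i).2 _ _⟩

/-! ### Terms and Birkhoff's theorem -/

/-- Formulas over an arbitrary set of variables. -/
inductive Term (X : Type u) : Type u
  | var : X → Term X
  | inf : Term X → Term X → Term X
  | sup : Term X → Term X → Term X
  | neg : Term X → Term X

namespace Term

variable {X : Type u}

/-- The value of a term under an assignment. -/
def eval (A : Alg.{u}) (g : X → A.carrier) : Term X → A.carrier
  | .var x => g x
  | .inf s t => A.inf (s.eval A g) (t.eval A g)
  | .sup s t => A.sup (s.eval A g) (t.eval A g)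
  | .neg s => A.neg (s.eval A g)

/-- Translation of terms into formulas along a numbering of the variables. -/
def toFm (e : X → ℕ) : Term X → Fm
  | .var x => .var (e x)
  | .inf s t => .inf (s.toFm e) (t.toFm e)
  | .sup s t => .sup (s.toFm e) (t.toFm e)
  | .neg s => .neg (s.toFm e)

theorem eval_toFm (e : X → ℕ) (A : Alg.{u}) (h : ℕ → A.carrier) (t : Term X) :
    (t.toFm e).eval A h = t.eval A fun x => h (e x) := by
  induction t with
  | var n => rfl
  | inf s t hs ht => simp only [toFm, Fm.eval, eval, hs, ht]
  | sup s t hs ht => simp only [toFm, Fm.eval, eval, hs, ht]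
  | neg s hs => simp only [toFm, Fm.eval, eval, hs]

/-- The variables of a term. -/
def vars : Term X → Set X
  | .var x => {x}
  | .inf s t => s.vars ∪ t.vars
  | .sup s t => s.vars ∪ t.vars
  | .neg s => s.vars

theorem countable_vars (t : Term X) : t.vars.Countable := by
  induction t with
  | var x => exact Set.countable_singleton x
  | inf s t hs ht => exact hs.union ht
  | sup s t hs ht => exact hs.union ht
  | neg s hs => exact hs

theorem eval_congr {A : Alg.{u}} {g g' : X → A.carrier} {t : Term X}
    (h : ∀ x ∈ t.vars, g x = g' x) : t.eval A g = t.eval A g' := by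
  induction t with
  | var x => exact h x rfl
  | inf s t hs ht =>
    exact congrArg₂ A.inf (hs fun x hx => h x (Or.inl hx)) (ht fun x hx => h x (Or.inr hx))
  | sup s t hs ht =>
    exact congrArg₂ A.sup (hs fun x hx => h x (Or.inl hx)) (ht fun x hx => h x (Or.inr hx))
  | neg s hs => exact congrArg A.neg (hs h)

/-- Identities between terms over arbitrary sets of variables are no stronger than those between
formulas over countably many variables, as only countably many variables occur in two terms. -/
theorem eval_eq_of_sat {κ : Type u} {B : κ → Alg.{u}} {A : Alg.{u}}
    (hA : ∀ φ ψ : Fm, (∀ k, Sat (B k) φ ψ) → Sat A φ ψ) {s t : Term X}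
    (hst : ∀ k (g : X → (B k).carrier), s.eval (B k) g = t.eval (B k) g) (g : X → A.carrier) :
    s.eval A g = t.eval A g := by
  classical
  have hc : (s.vars ∪ t.vars).Countable := s.countable_vars.union t.countable_vars
  obtain ⟨e, he⟩ := Set.countable_iff_exists_injOn.1 hc
  have key := hA (s.toFm e) (t.toFm e) fun k h => by rw [eval_toFm, eval_toFm, hst]
  -- The numbering `e` is injective on the variables that occur, so `g` factors through it there.
  have hX : ∀ n, ∃ a : A.carrier, ∀ x ∈ s.vars ∪ t.vars, e x = n → g x = a := fun n => by
    by_cases hn : ∃ x ∈ s.vars ∪ t.vars, e x = n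
    · obtain ⟨x, hx, rfl⟩ := hn
      exact ⟨g x, fun y hy hyx => by rw [he hy hx hyx]⟩
    · exact ⟨A.nonempty.some, fun x hx hxn => absurd ⟨x, hx, hxn⟩ hn⟩
  choose h hh using hX
  have := key h
  rw [eval_toFm, eval_toFm] at this
  rw [eval_congr fun x hx => hh (e x) x (Or.inl hx) rfl, this,
    eval_congr fun x hx => hh (e x) x (Or.inr hx) rfl]

end Term

/-- **Birkhoff's theorem**: an algebra that satisfies all identities common to a (small) family of
members of a variety belongs to the variety. It is a homomorphic image of the algebra of term
functions in the variables `A` on members of the family, a subalgebra of a power. -/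
theorem mem_of_sat {W : Set Alg.{u}} (hW : IsVariety W) {κ : Type u} {B : κ → Alg.{u}}
    (hB : ∀ k, B k ∈ W) {A : Alg.{u}} (hA : ∀ φ ψ : Fm, (∀ k, Sat (B k) φ ψ) → Sat A φ ψ) :
    A ∈ W := by
  let P : Alg.{u} := Alg.prod fun p : Σ k, A.carrier → (B k).carrier => B p.1
  let ev : Term A.carrier → P.carrier := fun t p => t.eval (B p.1) p.2
  let Q : Alg.{u} :=
    { carrier := Set.range ev
      nonempty := A.nonempty.map fun a => ⟨_, .var a, rfl⟩
      inf := fun x y => ⟨P.inf x y, by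
        obtain ⟨_, s, rfl⟩ := x; obtain ⟨_, t, rfl⟩ := y; exact ⟨.inf s t, rfl⟩⟩
      sup := fun x y => ⟨P.sup x y, by
        obtain ⟨_, s, rfl⟩ := x; obtain ⟨_, t, rfl⟩ := y; exact ⟨.sup s t, rfl⟩⟩
      neg := fun x => ⟨P.neg x, by obtain ⟨_, s, rfl⟩ := x; exact ⟨.neg s, rfl⟩⟩ }
  have hQ : Q ∈ W := hW.closed_S Q P Subtype.val (hW.closed_P _ _ fun p => hB p.1)
    ⟨fun _ _ => rfl, fun _ _ => rfl, fun _ => rfl⟩ Subtype.val_injective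
  have hwd : ∀ s t : Term A.carrier, ev s = ev t → s.eval A id = t.eval A id := fun s t h =>
    Term.eval_eq_of_sat hA (fun k g => congrFun h ⟨k, g⟩) id
  let f : Q.carrier → A.carrier := fun x => x.2.choose.eval A id
  have hf : ∀ t : Term A.carrier, f ⟨ev t, t, rfl⟩ = t.eval A id := fun t =>
    hwd _ _ (Set.mem_range_self t).choose_spec
  refine hW.closed_H Q A f hQ ⟨?_, ?_, ?_⟩ fun a => ⟨_, hf (.var a)⟩
  · rintro ⟨_, s, rfl⟩ ⟨_, t, rfl⟩
    rw [hf s, hf t]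
    exact hf (.inf s t)
  · rintro ⟨_, s, rfl⟩ ⟨_, t, rfl⟩
    rw [hf s, hf t]
    exact hf (.sup s t)
  · rintro ⟨_, s, rfl⟩
    rw [hf s]
    exact hf (.neg s)

/-! ### The coincidence of the four classes -/

theorem DML_subset_BDMBL : DML.{u} ⊆ BDMBL := fun A hA => by
  refine ⟨⟨hA.1.toIsDistribBisemilattice, hA.2⟩, fun x y => ?_⟩
  rw [hA.1.inf_absorb, hA.1.sup_assoc, hA.1.inf_absorb]

theorem lift_mem_DMBL {A : Alg.{0}} (hA : A ∈ DMBL) : A.lift ∈ DMBL.{u} := by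
  obtain ⟨⟨a, b, c, d, e, k, l, m⟩, ⟨n, o, p⟩⟩ := hA
  exact ⟨⟨fun _ => congrArg _ (a _), fun _ _ => congrArg _ (b _ _),
    fun _ _ _ => congrArg _ (c _ _ _), fun _ => congrArg _ (d _), fun _ _ => congrArg _ (e _ _),
    fun _ _ _ => congrArg _ (k _ _ _), fun _ _ _ => congrArg _ (l _ _ _),
    fun _ _ _ => congrArg _ (m _ _ _)⟩, ⟨fun _ => congrArg _ (n _), fun _ _ => congrArg _ (o _ _),
    fun _ _ => congrArg _ (p _ _)⟩⟩

theorem DM4_lift_mem_DML : DM4.lift.{u} ∈ DML := by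
  have : DM4 ∈ DML := by
    refine ⟨⟨⟨?_, ?_, ?_, ?_, ?_, ?_, ?_, ?_⟩, ?_, ?_⟩, ⟨?_, ?_, ?_⟩⟩ <;>
      dsimp only [DM4] <;> decide
  obtain ⟨⟨h, q, r⟩, hn⟩ := this
  obtain ⟨h', hn'⟩ := lift_mem_DMBL.{u} ⟨h, hn⟩
  exact ⟨⟨h', fun _ _ => congrArg _ (q _ _), fun _ _ => congrArg _ (r _ _)⟩, hn'⟩

theorem IS3_lift_mem_BDMBL : IS3.lift.{u} ∈ BDMBL := by
  have : IS3 ∈ BDMBL := by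
    refine ⟨⟨⟨?_, ?_, ?_, ?_, ?_, ?_, ?_, ?_⟩, ⟨?_, ?_, ?_⟩⟩, ?_⟩ <;>
      dsimp only [IS3, BAbs] <;> repeat' rintro (_ | _ | _)
    all_goals rfl
  exact ⟨lift_mem_DMBL this.1, fun _ _ => congrArg _ (this.2 _ _)⟩

/-- Bipolarly balanced identities of `DM₄` hold in bipolarly absorptive De Morgan bisemilattices:
in the Płonka decomposition both sides get the same index. -/
theorem sat_of_mem_BDMBL {A : Alg.{u}} (hA : A ∈ BDMBL) {φ ψ : Fm}
    (hb : BipolarlyBalanced φ ψ) (hs : Sat DM4 φ ψ) : Sat A φ ψ := by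
  let := indexSemilattice hA.1
  have := index_nonempty A
  obtain ⟨f, hf, hbij⟩ := isIso_plonkaSystem_sum hA.1
  refine Sat.of_injective hf hbij.injective fun h => InvSystem.eval_sum_eq _ hs h ?_
  rw [InvSystem.eval_sum_fst, InvSystem.eval_sum_fst]
  exact Fm.index_eq_of_bipolarlyBalanced (le_sup_inv_of_bAbs hA.1 hA.2) hb _

theorem BDMBL_subset_Bip_DML : BDMBL.{u} ⊆ Bip DML := fun _ hA _ _ hb hs =>
  sat_of_mem_BDMBL hA hb (sat_lift.1 (hs _ DM4_lift_mem_DML))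

theorem Bip_DML_subset_generatedVariety :
    Bip DML.{u} ⊆ generatedVariety {DM4.lift, IS3.lift} := fun A hA => by
  refine mem_of_sat (isVariety_generatedVariety _) (κ := ULift Bool)
    (B := fun b => if b.down then DM4.lift else IS3.lift) (fun b => ?_) fun φ ψ hs => ?_
  · refine subset_generatedVariety _ ?_
    obtain ⟨_ | _⟩ := b <;> simp
  · have hDM : Sat DM4 φ ψ := sat_lift.1 (by simpa using hs ⟨true⟩)
    have hIS : Sat IS3 φ ψ := sat_lift.1 (by simpa using hs ⟨false⟩)
    have hb := bipolarlyBalanced_of_sat_IS3 hIS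
    exact hA φ ψ hb fun B hB => sat_of_mem_BDMBL (DML_subset_BDMBL hB) hb hDM

theorem generatedVariety_subset_BDMBL :
    generatedVariety {DM4.lift.{u}, IS3.lift} ⊆ BDMBL := fun _ hA =>
  hA BDMBL isVariety_BDMBL <| Set.insert_subset (DML_subset_BDMBL DM4_lift_mem_DML) <|
    Set.singleton_subset_iff.2 IS3_lift_mem_BDMBL

/-- The involutive semilattices in the variety generated by `IS₃` are those in which every
`i ⊔ ¬i` is the top element. -/
theorem toAlg_mem_generatedVariety_IS3 {I : Type u} [InvSemilattice I] [Nonempty I] :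
    InvSemilattice.toAlg I ∈ generatedVariety {IS3.lift.{u}} ↔
      ∀ i j : I, j ≤ i ⊔ InvSemilattice.inv i := by
  refine ⟨fun h i j => ?_, fun h => ?_⟩
  · -- `BDMBL` contains `IS₃`, and where `∧` and `∨` are both the join, bipolar absorption reads
    -- `i ⊔ ¬i = i ⊔ ¬i ⊔ j`.
    have hI : InvSemilattice.toAlg I ∈ BDMBL :=
      h _ isVariety_BDMBL (Set.singleton_subset_iff.2 IS3_lift_mem_BDMBL)
    have e : i ⊔ (i ⊔ InvSemilattice.inv i) =
        i ⊔ (i ⊔ InvSemilattice.inv i) ⊔ (i ⊔ InvSemilattice.inv i ⊔ j) := hI.2 i j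
    rw [← sup_assoc, sup_idem] at e
    exact (le_sup_right.trans le_sup_right).trans e.ge
  · refine mem_of_sat (isVariety_generatedVariety _) (κ := PUnit) (B := fun _ => IS3.lift)
      (fun _ => subset_generatedVariety _ (Set.mem_singleton _)) fun φ ψ hs g => ?_
    have hb := bipolarlyBalanced_of_sat_IS3 (sat_lift.1 (hs ⟨⟩))
    exact (Fm.eval_toAlg (I := I) g φ).trans
      ((Fm.index_eq_of_bipolarlyBalanced h hb g).trans (Fm.eval_toAlg (I := I) g ψ).symm)

theorem BDMBL_eq_DMPlonkaSums :
    BDMBL.{u} = DMPlonkaSums (generatedVariety {IS3.lift}) := by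
  refine Set.Subset.antisymm (fun A hA => ?_) ?_
  · let := indexSemilattice hA.1
    have := index_nonempty A
    exact ⟨Index A, indexSemilattice hA.1, index_nonempty A, plonkaSystem hA.1,
      toAlg_mem_generatedVariety_IS3.2 (le_sup_inv_of_bAbs hA.1 hA.2),
      isIso_plonkaSystem_sum hA.1⟩
  · rintro A ⟨I, _, _, F, hI, f, hf, hbij⟩
    exact isVariety_BDMBL.closed_S A F.sum f
      ⟨F.sum_mem_DMBL, F.sum_bAbs (toAlg_mem_generatedVariety_IS3.1 hI)⟩ hf hbij.injective

theorem BDMBL_eq_Bip_DML : BDMBL.{u} = Bip DML :=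
  BDMBL_subset_Bip_DML.antisymm
    (Bip_DML_subset_generatedVariety.trans generatedVariety_subset_BDMBL)

theorem Bip_DML_eq_generatedVariety :
    Bip DML.{u} = generatedVariety {DM4.lift, IS3.lift} :=
  Bip_DML_subset_generatedVariety.antisymm
    (generatedVariety_subset_BDMBL.trans BDMBL_subset_Bip_DML)

end DMPlonka

theorem mainTheorem2 :
    (DMPlonka.BDMBL.{u} = DMPlonka.Bip DMPlonka.DML.{u} ∧
      DMPlonka.Bip DMPlonka.DML.{u} =
        DMPlonka.generatedVariety {DMPlonka.DM4.lift, DMPlonka.IS3.lift} ∧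
      DMPlonka.generatedVariety {DMPlonka.DM4.lift.{u}, DMPlonka.IS3.lift} =
        DMPlonka.DMPlonkaSums (DMPlonka.generatedVariety {DMPlonka.IS3.lift})) ∧
    DMPlonka.IsVariety DMPlonka.BDMBL.{u} ∧
    (∀ φ ψ : DMPlonka.Fm,
      DMPlonka.ClassSat (DMPlonka.Bip DMPlonka.DML.{u}) φ ψ ↔
        DMPlonka.BipolarlyBalanced φ ψ ∧ DMPlonka.ClassSat DMPlonka.DML.{u} φ ψ) := by
  open DMPlonka in
  refine ⟨⟨BDMBL_eq_Bip_DML, Bip_DML_eq_generatedVariety, ?_⟩, isVariety_BDMBL,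
    fun φ ψ => ⟨fun h => ⟨?_, ?_⟩, fun h A hA => hA φ ψ h.1 h.2⟩⟩
  · rw [← Bip_DML_eq_generatedVariety, ← BDMBL_eq_Bip_DML, BDMBL_eq_DMPlonkaSums]
  · exact bipolarlyBalanced_of_sat_IS3
      (sat_lift.1 (h _ (BDMBL_subset_Bip_DML IS3_lift_mem_BDMBL)))
  · exact fun A hA => h A (BDMBL_subset_Bip_DML (DML_subset_BDMBL hA))
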